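/- Let $p$ be a prime, let $\mathbb{F}_q$ be a finite field of characteristic $p$, and let $\ell>1$ and $e\ge 1$ be integers with $\gcd(\ell,p)=1$. Let $n=\ell p^e$ and let $\mathcal{D}\subseteq\mathbb{F}_q^{\,n}$ be a nonzero cyclic code, that is, a nonzero linear subspace invariant under $(x_0,\dots,x_{n-1})\mapsto(x_{n-1},x_0,\dots,x_{n-2})$ (a repeated-root cyclic code, since $p\mid n$). Let $k$ be its dimension, $d_H(\mathcal{D})$ its minimum Hamming distance, and $g(x)$ its generator polynomial, i.e. the monic divisor $g(x)$ of $x^{n}-1$ such that, identifying $(c_0,\dots,c_{n-1})$ with $c_0+c_1x+\dots+c_{n-1}x^{n-1}$, one has $\mathcal{D}=\{f(x)g(x)\bmod (x^{n}-1) : f(x)\in\mathbb{F}_q[x]\}$. The minimum pair distance $d_p(\mathcal{D})$ is the minimum, over distinct $\mathbf{a},\mathbf{b}\in\mathcal{D}$, of the number of indices $i\in\mathbb{Z}/n\mathbb{Z}$ with $(a_i,a_{i+1})\ne(b_i,b_{i+1})$. Suppose that $d_H(\mathcal{D})$ is a prime number and that at least one of the following two conditions holds: (1) $\ell<d_H(\mathcal{D})<\ell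 p^e-k$; (2) $x^\ell-1$ divides $g(x)$ and $2<d_H(\mathcal{D})<\ell p^e-k$. Then $d_p(\mathcal{D})\ge d_H(\mathcal{D})+3$. -/

import Mathlib

open Polynomial

namespace SymbolPair

/-- The cyclic shift `(x₀, x₁, …, xₙ₋₁) ↦ (xₙ₋₁, x₀, …, xₙ₋₂)` on words of length `n`. -/
def cyclicShift {S : Type*} {n : ℕ} (x : Fin n → S) : Fin n → S :=
  fun i => x ((finRotate n).symm i)

/-- A linear code `C` of length `n` is cyclic if it is invariant under the cyclic shift. -/
def IsCyclic {F : Type*} [Field F] {n : ℕ} (C : Submodule F (Fin n → F)) : Prop :=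
  cyclicShift '' (C : Set (Fin n → F)) = (C : Set (Fin n → F))

/-- The symbol-pair read vector `[(a₀, a₁), (a₁, a₂), …, (aₙ₋₂, aₙ₋₁), (aₙ₋₁, a₀)]` of `a`. -/
def pairRead {S : Type*} {n : ℕ} (a : Fin n → S) : Fin n → S × S :=
  fun i => (a i, a (finRotate n i))

/-- The pair distance of two words: the Hamming distance of their symbol-pair read vectors. -/
def pairDist {S : Type*} [DecidableEq S] {n : ℕ} (a b : Fin n → S) : ℕ :=
  hammingDist (pairRead a) (pairRead b)

/-- The minimum Hamming distance of a code (with at least two codewords). -/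
noncomputable def minHammingDist {S : Type*} [DecidableEq S] {n : ℕ} (C : Set (Fin n → S)) : ℕ :=
  sInf {m : ℕ | ∃ a ∈ C, ∃ b ∈ C, a ≠ b ∧ hammingDist a b = m}

/-- The minimum pair distance of a code (with at least two codewords). -/
noncomputable def minPairDist {S : Type*} [DecidableEq S] {n : ℕ} (C : Set (Fin n → S)) : ℕ :=
  sInf {m : ℕ | ∃ a ∈ C, ∃ b ∈ C, a ≠ b ∧ pairDist a b = m}

/-- The polynomial representation `c₀ + c₁ x + ⋯ + cₙ₋₁ xⁿ⁻¹` of a word. -/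
noncomputable def wordPoly {F : Type*} [Field F] {n : ℕ} (c : Fin n → F) : F[X] :=
  ∑ i : Fin n, C (c i) * X ^ (i : ℕ)

/-- `g` is the generator polynomial of the code `D` of length `n`: it is a monic divisor of
`xⁿ - 1`, and the codewords are exactly the words represented by `f g mod (xⁿ - 1)`. -/
def IsGeneratorPoly {F : Type*} [Field F] {n : ℕ} (g : F[X])
    (D : Submodule F (Fin n → F)) : Prop :=
  g.Monic ∧ g ∣ X ^ n - 1 ∧
    ∀ c : Fin n → F, c ∈ D ↔ ∃ f : F[X], wordPoly c = (f * g) %ₘ (X ^ n - 1)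

end SymbolPair

/-! The pair weight of a word is its Hamming weight plus its number of cyclic runs of nonzero
entries (`pairDist_eq`). A word of weight `d` has all its nonzero positions in one class mod `l`
(`exists_residue_of_minimum`), so no two are adjacent and its pair weight is `2 * d ≥ d + 3`. A
heavier word of pair weight at most `d + 2` has at most one run. One run, shifted to the start,
forces `n < k + d + 1` (`lt_finrank_add`). No run start means full weight, hence `k = 1`, and then
all nonzero codewords have the same weight.

For the residue statement, write a minimum word as `(x^l - 1)^t * v` with `x^l - 1` not dividing
`v`; let `N` be the weight of `v` mod `x^l - 1` and `w` that of `(x - 1)^t`. Splitting by exponents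
mod `l` gives `d ≥ N * w`, and `exists_hammingNorm_le` gives a codeword of weight at most `w * N`.
So `d = w * N` is prime; the alternative conditions exclude `t = 0`, hence `w ≥ 2` and `N = 1`. -/

namespace SymbolPair

/-! ### Splitting polynomials by exponents mod `m` -/

section ResiduePart

variable {F : Type*} [Field F]

/-- The polynomial collecting the coefficients of `f` at the exponents `m * i + j`. -/
noncomputable def residuePart (m j : ℕ) (f : F[X]) : F[X] :=
  ∑ i ∈ Finset.range (f.natDegree + 1), monomial i (f.coeff (m * i + j))

lemma coeff_residuePart {m : ℕ} (hm : 0 < m) (j : ℕ) (f : F[X]) (i : ℕ) :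
    (residuePart m j f).coeff i = f.coeff (m * i + j) := by
  simp only [residuePart, finsetSum_coeff, coeff_monomial, Finset.sum_ite_eq', Finset.mem_range]
  split_ifs with h
  · rfl
  · refine (coeff_eq_zero_of_natDegree_lt ?_).symm
    nlinarith

/-- A factor in `x^m` does not mix residue classes of exponents. -/
lemma residuePart_expand_mul {m j : ℕ} (hj : j < m) (a f : F[X]) :
    residuePart m j (expand F m a * f) = a * residuePart m j f := by
  have hm : 0 < m := by omega
  induction a using Polynomial.induction_on' with
  | add a b ha hb =>
    ext i
    have ha' := congrArg (fun q => coeff q i) ha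
    have hb' := congrArg (fun q => coeff q i) hb
    simp only [coeff_residuePart hm] at ha' hb'
    rw [coeff_residuePart hm, map_add, add_mul, add_mul, coeff_add, coeff_add, ha', hb']
  | monomial k r =>
    ext i
    rw [coeff_residuePart hm, expand_monomial, ← C_mul_X_pow_eq_monomial,
      ← C_mul_X_pow_eq_monomial, mul_assoc, mul_assoc, coeff_C_mul, coeff_C_mul,
      coeff_X_pow_mul', coeff_X_pow_mul']
    congr 1
    by_cases h : k ≤ i
    · obtain ⟨i, rfl⟩ := Nat.exists_eq_add_of_le h
      have h' : k * m ≤ m * (k + i) + j := by nlinarith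
      rw [if_pos h, if_pos h', coeff_residuePart hm]
      congr 1
      rw [Nat.add_sub_cancel_left, Nat.mul_add, mul_comm k m]
      omega
    · have h' : ¬ k * m ≤ m * i + j := by nlinarith
      rw [if_neg h, if_neg h']

lemma sum_X_pow_mul_expand_residuePart {m : ℕ} (hm : 0 < m) (f : F[X]) :
    ∑ j ∈ Finset.range m, X ^ j * expand F m (residuePart m j f) = f := by
  ext k
  rw [finsetSum_coeff, Finset.sum_eq_single (k % m)]
  · rw [coeff_X_pow_mul', if_pos (Nat.mod_le k m), coeff_expand hm,
      if_pos (Nat.dvd_sub_mod k), coeff_residuePart hm]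
    congr 1
    rw [Nat.mul_div_cancel' (Nat.dvd_sub_mod k)]
    have := Nat.mod_le k m
    omega
  · intro j hj hne
    rw [coeff_X_pow_mul']
    split_ifs with h
    · rw [coeff_expand hm, if_neg]
      intro hd
      apply hne
      have := (Nat.modEq_iff_dvd' h).2 hd
      rw [← Nat.mod_eq_of_lt (Finset.mem_range.1 hj)]
      exact this
    · rfl
  · intro h
    exact absurd (Finset.mem_range.2 (Nat.mod_lt k hm)) h

lemma sum_card_support_residuePart {m : ℕ} (hm : 0 < m) (f : F[X]) :
    ∑ j ∈ Finset.range m, (residuePart m j f).support.card = f.support.card := by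
  rw [Finset.card_eq_sum_card_fiberwise (f := fun k => k % m) (t := Finset.range m)
    (fun k _ => by simpa using Nat.mod_lt k hm)]
  refine Finset.sum_congr rfl fun j hj => ?_
  rw [Finset.mem_range] at hj
  refine Finset.card_bij (fun i _ => m * i + j) ?_ ?_ ?_
  · intro i hi
    rw [mem_support_iff, coeff_residuePart hm] at hi
    simpa [Nat.mod_eq_of_lt hj] using hi
  · intro a _ b _ h
    exact Nat.eq_of_mul_eq_mul_left hm (by simpa using h)
  · intro k hk
    rw [Finset.mem_filter, mem_support_iff] at hk
    have hk' : m * (k / m) + j = k := by rw [← hk.2]; exact Nat.div_add_mod k m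
    refine ⟨k / m, ?_, hk'⟩
    rw [mem_support_iff, coeff_residuePart hm, hk']
    exact hk.1

/-- The remainder of `h` modulo `X ^ m - 1`, written out by residue classes of exponents. -/
noncomputable def fold (m : ℕ) (h : F[X]) : F[X] :=
  ∑ j ∈ Finset.range m, monomial j ((residuePart m j h).eval 1)

lemma coeff_fold (m : ℕ) (h : F[X]) (i : ℕ) :
    (fold m h).coeff i = if i < m then (residuePart m i h).eval 1 else 0 := by
  simp [fold, coeff_monomial]

lemma support_fold_subset (m : ℕ) (h : F[X]) : (fold m h).support ⊆ Finset.range m := by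
  intro i hi
  rw [mem_support_iff, coeff_fold] at hi
  by_contra h'
  exact hi (if_neg (by simpa using h'))

lemma X_pow_sub_one_dvd_sub_fold {m : ℕ} (hm : 0 < m) (h : F[X]) :
    X ^ m - 1 ∣ h - fold m h := by
  have key : h - fold m h = ∑ j ∈ Finset.range m, (X ^ j * expand F m (residuePart m j h) -
      monomial j ((residuePart m j h).eval 1)) := by
    rw [Finset.sum_sub_distrib, sum_X_pow_mul_expand_residuePart hm h, fold]
  rw [key]
  refine Finset.dvd_sum fun j _ => ?_
  have h1 : X - C 1 ∣ residuePart m j h - C ((residuePart m j h).eval 1) :=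
    X_sub_C_dvd_sub_C_eval
  have h2 := map_dvd (expand F m) h1
  simp only [map_sub, expand_X, expand_C, map_one] at h2
  rw [← C_mul_X_pow_eq_monomial, mul_comm (C _), ← mul_sub]
  exact h2.mul_left _

lemma fold_ne_zero {m : ℕ} (hm : 0 < m) {h : F[X]} (hh : ¬ X ^ m - 1 ∣ h) : fold m h ≠ 0 := by
  intro h0
  have := X_pow_sub_one_dvd_sub_fold hm h
  rw [h0, sub_zero] at this
  exact hh this

lemma expand_X_sub_one_pow (m t : ℕ) : expand F m ((X - 1) ^ t) = (X ^ m - 1) ^ t := by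
  simp

lemma residuePart_X_pow_sub_one_pow_mul {m j : ℕ} (hj : j < m) (t : ℕ) (f : F[X]) :
    residuePart m j ((X ^ m - 1) ^ t * f) = (X - 1) ^ t * residuePart m j f := by
  rw [← expand_X_sub_one_pow, residuePart_expand_mul hj]

end ResiduePart

/-! ### Weight and order of vanishing at 1 -/

section BinomialWeight

variable {F : Type*} [Field F]

/-- The number of nonzero coefficients of `(X - 1) ^ t`. -/
noncomputable def binomialWeight (F : Type*) [Field F] (t : ℕ) : ℕ :=
  ((X - 1 : F[X]) ^ t).support.card

lemma X_sub_one_ne_zero : (X - 1 : F[X]) ≠ 0 := by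
  simpa using X_sub_C_ne_zero (1 : F)

lemma natDegree_X_sub_one_pow (t : ℕ) : ((X - 1 : F[X]) ^ t).natDegree = t := by
  rw [natDegree_pow, ← C_1, natDegree_X_sub_C, mul_one]

lemma binomialWeight_zero : binomialWeight F 0 = 1 := by
  rw [binomialWeight, pow_zero, ← C_1, support_C one_ne_zero, Finset.card_singleton]

lemma two_le_binomialWeight {t : ℕ} (ht : t ≠ 0) : 2 ≤ binomialWeight F t := by
  by_contra! h
  obtain ⟨k, a, hka⟩ := card_support_le_one_iff_monomial.1 (Nat.le_of_lt_succ h)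
  have h1 := congrArg (eval 1) hka
  simp only [eval_pow, eval_sub, eval_X, eval_one, sub_self, zero_pow ht, eval_monomial, one_pow,
    mul_one] at h1
  rw [← h1, monomial_zero_right] at hka
  exact pow_ne_zero t X_sub_one_ne_zero hka

lemma card_support_le_X_pow_mul (k : ℕ) (r : F[X]) :
    r.support.card ≤ (X ^ k * r).support.card := by
  refine Finset.card_le_card_of_injOn (fun i => i + k) ?_ ?_
  · intro i hi
    simpa [mem_support_iff, coeff_X_pow_mul] using hi
  · intro a _ b _ h
    simpa using h

lemma card_support_derivative_add_one_le {r : F[X]} (h0 : r.coeff 0 ≠ 0) :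
    (derivative r).support.card + 1 ≤ r.support.card := by
  rw [← Finset.card_erase_add_one (mem_support_iff.2 h0)]
  refine Nat.add_le_add_right (Finset.card_le_card_of_injOn (fun i => i + 1) ?_ ?_) 1
  · intro i hi
    have hi' : (derivative r).coeff i ≠ 0 := mem_support_iff.1 hi
    rw [coeff_derivative] at hi'
    simpa [mem_support_iff] using left_ne_zero_of_mul hi'
  · intro a _ b _ h
    simpa using h

/-- After removing powers of `X`, differentiation kills the constant term and costs one order of
vanishing; below degree `p` it behaves as in characteristic zero. -/
lemma add_one_le_card_support_of_X_sub_one_pow_dvd (p : ℕ) [CharP F p] {t : ℕ} {q : F[X]}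
    (hq : q ≠ 0) (hdeg : q.natDegree < p) (hdvd : (X - 1) ^ t ∣ q) :
    t + 1 ≤ q.support.card := by
  induction t generalizing q with
  | zero =>
    rw [zero_add, Nat.succ_le_iff, Finset.card_pos, nonempty_support_iff]
    exact hq
  | succ t ih =>
    obtain ⟨r, hr, hr0⟩ := exists_eq_pow_rootMultiplicity_mul_and_not_dvd q hq 0
    rw [C_0, sub_zero] at hr hr0
    set k := rootMultiplicity 0 q
    have hrne : r ≠ 0 := by rintro rfl; simp at hr0
    have hcoeff : r.coeff 0 ≠ 0 := fun h => hr0 (X_dvd_iff.2 h)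
    have hrdeg : r.natDegree < p := by
      rw [hr, natDegree_mul (pow_ne_zero _ X_ne_zero) hrne] at hdeg
      omega
    have hcop : IsCoprime ((X - 1 : F[X]) ^ (t + 1)) (X ^ k) :=
      IsCoprime.pow ⟨-1, 1, by ring⟩
    have hrd : (X - 1) ^ (t + 1) ∣ r := hcop.dvd_of_dvd_mul_left (hr ▸ hdvd)
    have hder : (X - 1) ^ t ∣ derivative r := by
      simpa using pow_sub_one_dvd_derivative_of_pow_dvd hrd
    have hpos : t + 1 ≤ r.natDegree :=
      (natDegree_X_sub_one_pow (F := F) (t + 1)).symm.trans_le (natDegree_le_of_dvd hrd hrne)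
    have hdne : derivative r ≠ 0 := by
      intro h
      have h1 := congrArg (fun s => coeff s (r.natDegree - 1)) h
      obtain ⟨e, he⟩ : ∃ e, r.natDegree = e + 1 := ⟨r.natDegree - 1, by omega⟩
      simp only [coeff_derivative, coeff_zero, he, Nat.add_sub_cancel, mul_eq_zero] at h1
      rcases h1 with h1 | h1
      · rw [← he, coeff_natDegree, leadingCoeff_eq_zero] at h1
        exact hrne h1
      · have h2 : ((e + 1 : ℕ) : F) = 0 := by exact_mod_cast h1
        rw [CharP.cast_eq_zero_iff F p] at h2
        have := Nat.le_of_dvd (by omega) h2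
        omega
    have hddeg : (derivative r).natDegree < p := (natDegree_derivative_le r).trans_lt (by omega)
    calc t + 1 + 1 ≤ (derivative r).support.card + 1 := Nat.add_le_add_right (ih hdne hddeg hder) 1
      _ ≤ r.support.card := card_support_derivative_add_one_le hcoeff
      _ ≤ q.support.card := by rw [hr]; exact card_support_le_X_pow_mul k r

lemma card_support_expand_le {m : ℕ} (hm : 0 < m) (f : F[X]) :
    (expand F m f).support.card ≤ f.support.card := by
  refine (Finset.card_le_card (t := f.support.image fun i => i * m) fun i hi => ?_).trans
    Finset.card_image_le
  rw [mem_support_iff, coeff_expand hm, ne_eq, ite_eq_right_iff, Classical.not_imp] at hi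
  exact Finset.mem_image.2 ⟨i / m, mem_support_iff.2 hi.2, Nat.div_mul_cancel hi.1⟩

lemma not_X_sub_one_pow_succ_dvd {t : ℕ} {u : F[X]} (hu : u.eval 1 ≠ 0) :
    ¬ (X - 1) ^ (t + 1) ∣ (X - 1) ^ t * u := by
  rw [pow_succ, mul_dvd_mul_iff_left (pow_ne_zero t X_sub_one_ne_zero), ← C_1, dvd_iff_isRoot]
  exact hu

lemma le_of_X_sub_one_pow_dvd {s t : ℕ} {u : F[X]} (hu : u.eval 1 ≠ 0)
    (h : (X - 1) ^ s ∣ (X - 1) ^ t * u) : s ≤ t := by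
  by_contra! hlt
  exact not_X_sub_one_pow_succ_dvd hu ((pow_dvd_pow _ hlt).trans h)

lemma exists_eq_X_pow_sub_one_pow_mul {m : ℕ} (hm : 0 < m) {f : F[X]} (hf : f ≠ 0) :
    ∃ t h, f = (X ^ m - 1) ^ t * h ∧ ¬ X ^ m - 1 ∣ h := by
  have hfin : FiniteMultiplicity (X ^ m - 1 : F[X]) f := by
    refine FiniteMultiplicity.of_not_isUnit ?_ hf
    intro hu
    have := natDegree_eq_zero_of_isUnit hu
    rw [← C_1, natDegree_X_pow_sub_C] at this
    omega
  obtain ⟨h, h1, h2⟩ := hfin.exists_eq_pow_mul_and_not_dvd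
  exact ⟨_, h, h1, h2⟩

/-- A power `t` for which `binomialWeight F t` bounds weights from below gives, for every modulus,
a bound by the number of residue classes not vanishing at `1`. -/
lemma card_support_fold_mul_le {m : ℕ} (hm : 0 < m) {t b : ℕ}
    (hb : ∀ u : F[X], u.eval 1 ≠ 0 → b ≤ ((X - 1) ^ t * u).support.card) (h : F[X]) :
    (fold m h).support.card * b ≤ ((X ^ m - 1) ^ t * h).support.card := by
  rw [← sum_card_support_residuePart hm ((X ^ m - 1) ^ t * h), ← smul_eq_mul]
  refine (Finset.card_nsmul_le_sum (fold m h).support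
    (fun j => (residuePart m j ((X ^ m - 1) ^ t * h)).support.card) b ?_).trans
    (Finset.sum_le_sum_of_subset (support_fold_subset m h))
  intro j hj
  have hjm := Finset.mem_range.1 (support_fold_subset m h hj)
  rw [mem_support_iff, coeff_fold, if_pos hjm] at hj
  simp only [residuePart_X_pow_sub_one_pow_mul hjm]
  exact hb _ hj

/-- A polynomial over a field of characteristic `p` with a zero of exact order `t` at `1` has at
least as many nonzero coefficients as `(X - 1) ^ t`. -/
theorem binomialWeight_le_card_support (p : ℕ) [Fact p.Prime] [CharP F p] (t : ℕ) (u : F[X])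
    (hu : u.eval 1 ≠ 0) : binomialWeight F t ≤ ((X - 1) ^ t * u).support.card := by
  induction t using Nat.strong_induction_on generalizing u with
  | _ t ih =>
  have hp : p.Prime := Fact.out
  have hune : u ≠ 0 := by rintro rfl; simp at hu
  have hf : (X - 1) ^ t * u ≠ 0 := mul_ne_zero (pow_ne_zero t X_sub_one_ne_zero) hune
  rcases Nat.eq_zero_or_pos t with rfl | ht
  · rw [binomialWeight_zero, Nat.succ_le_iff, Finset.card_pos, nonempty_support_iff]
    exact hf
  -- Since `X^p - 1 = (X - 1)^p`, this is division with remainder: `t = p * T + s` with `s < p`.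
  obtain ⟨T, h, hfh, hnd⟩ := exists_eq_X_pow_sub_one_pow_mul hp.pos hf
  have hchar : (X ^ p - 1 : F[X]) = (X - 1) ^ p := by rw [sub_pow_char, one_pow]
  have hTle : p * T ≤ t := by
    refine le_of_X_sub_one_pow_dvd hu ?_
    rw [pow_mul, ← hchar, hfh]
    exact dvd_mul_right _ _
  obtain ⟨s, hs⟩ := Nat.exists_eq_add_of_le hTle
  have hTt : T < t := by nlinarith [hp.two_le]
  have hh : h = (X - 1) ^ s * u := by
    have h1 : ((X - 1 : F[X]) ^ p) ^ T ≠ 0 := pow_ne_zero _ (pow_ne_zero _ X_sub_one_ne_zero)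
    apply mul_left_cancel₀ h1
    rw [hchar] at hfh
    rw [← hfh, ← mul_assoc, ← pow_mul, ← pow_add, hs]
  have hsp : s < p := by
    by_contra! hle
    apply hnd
    rw [hchar, hh]
    exact (pow_dvd_pow _ hle).mul_right _
  have hfold : s + 1 ≤ (fold p h).support.card := by
    refine add_one_le_card_support_of_X_sub_one_pow_dvd p (fold_ne_zero hp.pos hnd) ?_ ?_
    · exact Finset.mem_range.1 (support_fold_subset p h
        (natDegree_mem_support_of_nonzero (fold_ne_zero hp.pos hnd)))
    · have h1 : (X - 1) ^ s ∣ h - fold p h := by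
        refine (pow_dvd_pow _ hsp.le).trans ?_
        rw [← hchar]
        exact X_pow_sub_one_dvd_sub_fold hp.pos h
      have h2 : (X - 1) ^ s ∣ h := hh ▸ dvd_mul_right _ _
      exact (dvd_sub_right h2).1 h1
  -- `(X - 1)^t` is `(X - 1)^s`, with at most `s + 1` terms, times `(X^p - 1)^T`.
  have hbw : binomialWeight F t ≤ (s + 1) * binomialWeight F T := by
    rw [binomialWeight, hs, add_comm, pow_add, pow_mul, ← hchar, ← expand_X_sub_one_pow]
    refine card_support_mul_le.trans (Nat.mul_le_mul ?_ (card_support_expand_le hp.pos _))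
    exact (card_supp_le_succ_natDegree _).trans_eq (by rw [natDegree_X_sub_one_pow])
  rw [hfh]
  exact hbw.trans ((Nat.mul_le_mul_right _ hfold).trans
    (card_support_fold_mul_le hp.pos (ih T hTt) h))

end BinomialWeight

/-! ### Codewords as polynomials -/

section WordPoly

variable {F : Type*} [Field F] {n : ℕ}

lemma coeff_wordPoly (c : Fin n → F) (i : ℕ) :
    (wordPoly c).coeff i = if h : i < n then c ⟨i, h⟩ else 0 := by
  simp only [wordPoly, finsetSum_coeff, coeff_C_mul, coeff_X_pow, mul_ite, mul_one, mul_zero]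
  split_ifs with h
  · rw [Finset.sum_eq_single ⟨i, h⟩]
    · simp
    · intro j _ hj
      exact if_neg fun h' => hj (Fin.ext h'.symm)
    · simp
  · exact Finset.sum_eq_zero fun j _ => if_neg fun h' : i = j => h (h'.trans_lt j.2)

lemma coeff_wordPoly_fin (c : Fin n → F) (i : Fin n) : (wordPoly c).coeff i = c i := by
  rw [coeff_wordPoly, dif_pos i.2]

lemma degree_wordPoly_lt (c : Fin n → F) : (wordPoly c).degree < n := by
  rw [degree_lt_iff_coeff_zero]
  intro i hi
  rw [coeff_wordPoly, dif_neg (by omega)]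

lemma wordPoly_coeff {f : F[X]} (hf : f.degree < n) : wordPoly (fun i : Fin n => f.coeff i) = f := by
  ext i
  rw [coeff_wordPoly]
  split_ifs with h
  · rfl
  · exact ((degree_lt_iff_coeff_zero f n).1 hf i (by omega)).symm

lemma wordPoly_ne_zero {c : Fin n → F} (hc : c ≠ 0) : wordPoly c ≠ 0 := by
  intro h
  apply hc
  ext i
  rw [← coeff_wordPoly_fin c i, h, coeff_zero, Pi.zero_apply]

lemma card_support_wordPoly [DecidableEq F] (c : Fin n → F) :
    (wordPoly c).support.card = hammingNorm c := by
  symm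
  refine Finset.card_bij (fun i _ => (i : ℕ)) ?_ ?_ ?_
  · intro i hi
    rw [mem_support_iff, coeff_wordPoly_fin]
    simpa using hi
  · intro a _ b _ h
    exact Fin.ext h
  · intro i hi
    rw [mem_support_iff, coeff_wordPoly] at hi
    split_ifs at hi with h
    · exact ⟨⟨i, h⟩, by simpa using hi, rfl⟩
    · exact absurd rfl hi

lemma monic_X_pow_sub_one (hn : 0 < n) : (X ^ n - 1 : F[X]).Monic := by
  simpa using monic_X_pow_sub_C (1 : F) hn.ne'

lemma degree_X_pow_sub_one (hn : 0 < n) : (X ^ n - 1 : F[X]).degree = n := by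
  simpa using degree_X_pow_sub_C hn (1 : F)

/-- Reduction sends `x^i` to `x^(i % n)`, so terms can merge or cancel but not multiply. -/
lemma card_support_modByMonic_X_pow_sub_one_le (hn : 0 < n) (f : F[X]) :
    (f %ₘ (X ^ n - 1)).support.card ≤ f.support.card := by
  have hmon : (X ^ n - 1 : F[X]).Monic := monic_X_pow_sub_one hn
  have hred : f %ₘ (X ^ n - 1) = ∑ i ∈ f.support, C (f.coeff i) * X ^ (i % n) := by
    refine (div_modByMonic_unique (f := f)
      (∑ i ∈ f.support, C (f.coeff i) * X ^ (i % n) * ((X ^ n) ^ (i / n) - 1) /ₘ (X ^ n - 1)) _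
      hmon ⟨?_, ?_⟩).2
    · rw [Finset.mul_sum, ← Finset.sum_add_distrib]
      conv_rhs => rw [as_sum_support_C_mul_X_pow f]
      refine Finset.sum_congr rfl fun i _ => ?_
      have hd : (X ^ n - 1 : F[X]) ∣ C (f.coeff i) * X ^ (i % n) * ((X ^ n) ^ (i / n) - 1) := by
        refine Dvd.dvd.mul_left ?_ _
        simpa using sub_dvd_pow_sub_pow (X ^ n : F[X]) 1 (i / n)
      obtain ⟨w, hw⟩ := hd
      rw [hw, mul_divByMonic_cancel_left _ hmon, ← hw,
        mul_sub, mul_one, add_sub_cancel, mul_assoc, ← pow_mul, ← pow_add, Nat.mod_add_div]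
    · rw [degree_X_pow_sub_one hn, degree_lt_iff_coeff_zero]
      intro k hk
      rw [finsetSum_coeff]
      refine Finset.sum_eq_zero fun i _ => ?_
      rw [coeff_C_mul_X_pow, if_neg]
      have := Nat.mod_lt i hn
      omega
  refine (Finset.card_le_card (t := f.support.image fun i => i % n) fun k hk => ?_).trans
    Finset.card_image_le
  rw [hred, mem_support_iff, finsetSum_coeff] at hk
  obtain ⟨i, hi, hne⟩ := Finset.exists_ne_zero_of_sum_ne_zero hk
  rw [coeff_C_mul_X_pow] at hne
  refine Finset.mem_image.2 ⟨i, hi, ?_⟩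
  by_contra h
  exact hne (if_neg fun h' => h h'.symm)

lemma dvd_modByMonic_of_dvd {g f q : F[X]} (hq : g ∣ q) (hf : g ∣ f) : g ∣ f %ₘ q := by
  have h := hq.trans (dvd_modByMonic_sub f q)
  exact (dvd_sub_left hf).1 h

lemma IsGeneratorPoly.mem_iff_dvd {g : F[X]} {D : Submodule F (Fin n → F)}
    (hg : IsGeneratorPoly g D) (hn : 0 < n) (c : Fin n → F) : c ∈ D ↔ g ∣ wordPoly c := by
  rw [hg.2.2 c]
  constructor
  · rintro ⟨f, hf⟩
    rw [hf]
    exact dvd_modByMonic_of_dvd hg.2.1 (dvd_mul_left g f)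
  · rintro ⟨f, hf⟩
    refine ⟨f, ?_⟩
    rw [mul_comm f g, ← hf, (modByMonic_eq_self_iff (monic_X_pow_sub_one hn)).2]
    rw [degree_X_pow_sub_one hn]
    exact degree_wordPoly_lt c

/-- If a nonzero codeword is concentrated on the first `s` positions, then the code has dimension
more than `n - s`. -/
lemma IsGeneratorPoly.lt_finrank_add {g : F[X]} {D : Submodule F (Fin n → F)}
    (hg : IsGeneratorPoly g D) {c : Fin n → F} (hc : c ∈ D) (hc0 : c ≠ 0) {s : ℕ}
    (hs : ∀ i : Fin n, c i ≠ 0 → (i : ℕ) < s) (hsn : s ≤ n) :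
    n < Module.finrank F D + s := by
  have hn : 0 < n := by
    by_contra! h
    obtain rfl : n = 0 := by omega
    exact hc0 (Subsingleton.elim _ _)
  have hw0 := wordPoly_ne_zero hc0
  have hdeg : (wordPoly c).natDegree < s := by
    have h := leadingCoeff_ne_zero.2 hw0
    rw [leadingCoeff, coeff_wordPoly] at h
    split_ifs at h with h'
    · exact hs _ h
    · exact absurd rfl h
  -- Multipliers of degree at most `n - s` need no reduction, so they embed a space of dimension `n
  -- - s + 1` into the code.
  have hlt : ∀ f : degreeLT F (n - s + 1), ((f : F[X]) * wordPoly c).degree < n := by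
    rintro ⟨f, hf⟩
    rcases eq_or_ne f 0 with rfl | hf0
    · simp
    rw [mem_degreeLT, ← natDegree_lt_iff_degree_lt hf0] at hf
    rw [← natDegree_lt_iff_degree_lt (mul_ne_zero hf0 hw0), natDegree_mul hf0 hw0]
    omega
  let φ : degreeLT F (n - s + 1) →ₗ[F] D :=
    { toFun := fun f => ⟨fun i => ((f : F[X]) * wordPoly c).coeff i, by
        rw [hg.mem_iff_dvd hn, wordPoly_coeff (hlt f)]
        exact ((hg.mem_iff_dvd hn c).1 hc).mul_left _⟩
      map_add' := fun a b => by ext i; simp [add_mul]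
      map_smul' := fun r a => by ext i; simp }
  have hinj : Function.Injective φ := by
    intro a b hab
    have h1 := congrArg (fun d : D => wordPoly (d : Fin n → F)) hab
    have h2 : (a : F[X]) * wordPoly c = b * wordPoly c := by
      simpa only [φ, LinearMap.coe_mk, AddHom.coe_mk, wordPoly_coeff (hlt _)] using h1
    exact Subtype.ext (mul_right_cancel₀ hw0 h2)
  have := LinearMap.finrank_le_finrank_of_injective hinj
  rw [(degreeLTEquiv F (n - s + 1)).finrank_eq, Module.finrank_fin_fun] at this
  omega

end WordPoly

/-! ### Minimum-weight words of repeated-root codes -/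

section RepeatedRoot

variable {F : Type*} [Field F] (p : ℕ) [Fact p.Prime] [CharP F p]

lemma card_support_pow_char_pow_le (e : ℕ) (f : F[X]) :
    (f ^ p ^ e).support.card ≤ f.support.card := by
  rw [← map_iterateFrobenius_expand p f e]
  exact (Finset.card_le_card (support_map_subset _ _)).trans
    (card_support_expand_le (pow_pos (Fact.out : p.Prime).pos e) f)

lemma X_pow_mul_char_pow_sub_one (l e : ℕ) :
    (X ^ (l * p ^ e) - 1 : F[X]) = (X ^ l - 1) ^ p ^ e := by
  rw [sub_pow_char_pow, one_pow, pow_mul]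

/-- A codeword `(x ^ l - 1) ^ t v` of a repeated-root cyclic code yields a codeword of small
weight, namely `(x ^ l - 1) ^ t w ^ (p ^ e)` with `w` the remainder of `v` modulo `x ^ l - 1`. -/
lemma IsGeneratorPoly.exists_hammingNorm_le [DecidableEq F] {l e : ℕ} (hl : 0 < l)
    (hlp : l.Coprime p) {D : Submodule F (Fin (l * p ^ e) → F)} {g : F[X]}
    (hg : IsGeneratorPoly g D) {t : ℕ} (ht : t < p ^ e) {v : F[X]} (hv : ¬ X ^ l - 1 ∣ v)
    (hgv : g ∣ (X ^ l - 1) ^ t * v) :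
    ∃ c ∈ D, c ≠ 0 ∧ hammingNorm c ≤ binomialWeight F t * (fold l v).support.card := by
  have hp : p.Prime := Fact.out
  have hn : 0 < l * p ^ e := Nat.mul_pos hl (pow_pos hp.pos e)
  have hmon : (X ^ (l * p ^ e) - 1 : F[X]).Monic := monic_X_pow_sub_one hn
  have hXl : (X ^ l - 1 : F[X]) ≠ 0 := (monic_X_pow_sub_one hl).ne_zero
  set A : F[X] := (X ^ l - 1) ^ t * fold l v ^ p ^ e with hA
  have hdeg : (A %ₘ (X ^ (l * p ^ e) - 1)).degree < ((l * p ^ e : ℕ) : WithBot ℕ) :=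
    (degree_modByMonic_lt _ hmon).trans_eq (degree_X_pow_sub_one hn)
  -- `v` and its fold agree mod `x^l - 1`, so their `p^e`-th powers agree mod `x^n - 1`, which `g`
  -- divides.
  have hgA : g ∣ A := by
    have h1 : (X ^ (l * p ^ e) - 1 : F[X]) ∣ v ^ p ^ e - fold l v ^ p ^ e := by
      rw [X_pow_mul_char_pow_sub_one, ← sub_pow_char_pow]
      exact pow_dvd_pow_of_dvd (X_pow_sub_one_dvd_sub_fold hl v) _
    have h2 : g ∣ (X ^ l - 1) ^ t * v ^ p ^ e :=
      hgv.trans (mul_dvd_mul_left _ (dvd_pow_self v (pow_pos hp.pos e).ne'))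
    have h3 : g ∣ (X ^ l - 1) ^ t * (v ^ p ^ e - fold l v ^ p ^ e) := (hg.2.1.trans h1).mul_left _
    rw [mul_sub] at h3
    exact (dvd_sub_right h2).1 h3
  -- As `t < p^e`, vanishing would make `x^l - 1` divide a power of the fold; being squarefree (`l`
  -- is prime to `p`), it would divide the fold, hence `v`.
  have hne : A %ₘ (X ^ (l * p ^ e) - 1) ≠ 0 := by
    rw [ne_eq, modByMonic_eq_zero_iff_dvd hmon, X_pow_mul_char_pow_sub_one, hA]
    intro h
    have h1 : (X ^ l - 1 : F[X]) ^ t * (X ^ l - 1) ∣ (X ^ l - 1) ^ t * fold l v ^ p ^ e := by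
      refine dvd_trans ?_ h
      rw [← pow_succ]
      exact pow_dvd_pow _ ht
    rw [mul_dvd_mul_iff_left (pow_ne_zero t hXl)] at h1
    have hsep : (X ^ l - 1 : F[X]).Separable := by
      rw [X_pow_sub_one_separable_iff, ne_eq, CharP.cast_eq_zero_iff F p]
      intro hd
      have := Nat.eq_one_of_dvd_coprimes hlp hd dvd_rfl
      exact hp.one_lt.ne' this
    have h2 : X ^ l - 1 ∣ fold l v := hsep.squarefree.isRadical _ _ h1
    have h3 := X_pow_sub_one_dvd_sub_fold hl v
    exact hv ((dvd_sub_left h2).1 h3)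
  have hw := wordPoly_coeff hdeg
  refine ⟨fun i => (A %ₘ (X ^ (l * p ^ e) - 1)).coeff i, ?_, ?_, ?_⟩
  · rw [hg.mem_iff_dvd hn, hw]
    exact dvd_modByMonic_of_dvd hg.2.1 hgA
  · intro h
    rw [h] at hw
    apply hne
    rw [← hw]
    simp [wordPoly]
  · rw [← card_support_wordPoly, hw]
    refine (card_support_modByMonic_X_pow_sub_one_le hn A).trans ?_
    refine card_support_mul_le.trans (Nat.mul_le_mul ?_ (card_support_pow_char_pow_le p e _))
    rw [← expand_X_sub_one_pow]
    exact card_support_expand_le hl _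

/-- In a repeated-root cyclic code whose minimum distance is a prime, not accounted for by the
simple-root part, codewords of minimum weight live on one residue class of positions. -/
theorem IsGeneratorPoly.exists_residue_of_minimum [DecidableEq F] {l e : ℕ} (hl : 0 < l)
    (hlp : l.Coprime p) {D : Submodule F (Fin (l * p ^ e) → F)} {g : F[X]}
    (hg : IsGeneratorPoly g D) {c : Fin (l * p ^ e) → F} (hc : c ∈ D)
    (hprime : (hammingNorm c).Prime) (hmin : ∀ b ∈ D, b ≠ 0 → hammingNorm c ≤ hammingNorm b)
    (hcond : l < hammingNorm c ∨ X ^ l - 1 ∣ g) :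
    ∃ r, ∀ i, c i ≠ 0 → (i : ℕ) % l = r := by
  have hp : p.Prime := Fact.out
  have hn : 0 < l * p ^ e := Nat.mul_pos hl (pow_pos hp.pos e)
  have hc0 : c ≠ 0 := hammingNorm_pos_iff.1 hprime.pos
  have hw0 := wordPoly_ne_zero hc0
  have hgc := (hg.mem_iff_dvd hn c).1 hc
  obtain ⟨t, v, hcv, hv⟩ := exists_eq_X_pow_sub_one_pow_mul hl hw0
  have hv0 : v ≠ 0 := by rintro rfl; simp at hv
  have ht : t < p ^ e := by
    have h1 := degree_wordPoly_lt c
    rw [← natDegree_lt_iff_degree_lt hw0, hcv,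
      natDegree_mul (pow_ne_zero t (monic_X_pow_sub_one hl).ne_zero) hv0, natDegree_pow,
      natDegree_eq_of_degree_eq_some (degree_X_pow_sub_one hl)] at h1
    nlinarith
  have hlow : (fold l v).support.card * binomialWeight F t ≤ hammingNorm c := by
    rw [← card_support_wordPoly, hcv]
    exact card_support_fold_mul_le hl (binomialWeight_le_card_support p t) v
  obtain ⟨b, hb, hb0, hbw⟩ := hg.exists_hammingNorm_le p hl hlp ht hv (hcv ▸ hgc)
  have heq : hammingNorm c = binomialWeight F t * (fold l v).support.card :=
    le_antisymm ((hmin b hb hb0).trans hbw) (by rwa [mul_comm])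
  -- If `t = 0`, the weight is that of the fold, at most `l`; and if `x^l - 1` divides `g`, it
  -- divides `v`.
  have ht0 : t ≠ 0 := by
    rintro rfl
    rcases hcond with hcond | hcond
    · rw [binomialWeight_zero, one_mul] at heq
      have := Finset.card_le_card (support_fold_subset l v)
      rw [Finset.card_range] at this
      omega
    · rw [pow_zero, one_mul] at hcv
      exact hv (hcv ▸ hcond.trans hgc)
  have hone : (fold l v).support.card = 1 := by
    rcases (Nat.prime_mul_iff.1 (heq ▸ hprime)) with h | h
    · exact h.2
    · have := two_le_binomialWeight (F := F) ht0
      omega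
  rw [hone, mul_one] at heq
  obtain ⟨r, hr⟩ := Finset.card_eq_one.1 hone
  have hrmem : r ∈ (fold l v).support := by rw [hr]; exact Finset.mem_singleton_self r
  have hrl := support_fold_subset l v hrmem
  have hrl' := Finset.mem_range.1 hrl
  rw [mem_support_iff, coeff_fold, if_pos hrl'] at hrmem
  -- Class `r` alone accounts for the full weight, leaving nothing for the others.
  have hclass : (wordPoly c).support.card ≤ (residuePart l r (wordPoly c)).support.card := by
    rw [card_support_wordPoly, heq, hcv, residuePart_X_pow_sub_one_pow_mul hrl']
    exact binomialWeight_le_card_support p t _ hrmem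
  refine ⟨r, fun i hi => ?_⟩
  by_contra hir
  have hil : (i : ℕ) % l ∈ Finset.range l := Finset.mem_range.2 (Nat.mod_lt _ hl)
  have hpos : 0 < (residuePart l (i % l) (wordPoly c)).support.card := by
    refine Finset.card_pos.2 ⟨i / l, ?_⟩
    rw [mem_support_iff, coeff_residuePart hl, Nat.div_add_mod, coeff_wordPoly_fin]
    exact hi
  have hsum := Finset.add_le_sum (f := fun j => (residuePart l j (wordPoly c)).support.card)
    (fun j _ => Nat.zero_le _) hil hrl hir
  rw [sum_card_support_residuePart hl] at hsum
  omega

end RepeatedRoot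

/-! ### Iterated cyclic shifts -/

section Rotation

variable {F : Type*} [Field F] {n : ℕ}

lemma val_finRotate (i : Fin n) : (finRotate n i : ℕ) = (i + 1) % n := by
  obtain ⟨m, rfl⟩ : ∃ m, n = m + 1 := ⟨n - 1, by have := i.2; omega⟩
  rw [finRotate_apply, Fin.val_add, Fin.val_one', Nat.add_mod_mod]

lemma val_finRotate_pow (s : ℕ) (i : Fin n) : ((finRotate n ^ s) i : ℕ) = (i + s) % n := by
  induction s with
  | zero => simp [Nat.mod_eq_of_lt i.2]
  | succ s ih => rw [pow_succ', Equiv.Perm.mul_apply, val_finRotate, ih, Nat.mod_add_mod, add_assoc]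

lemma IsCyclic.comp_finRotate_pow_mem {D : Submodule F (Fin n → F)} (hD : IsCyclic D)
    {c : Fin n → F} (hc : c ∈ D) (s : ℕ) : (fun i => c ((finRotate n ^ s) i)) ∈ D := by
  induction s with
  | zero => exact hc
  | succ s ih =>
    have h : (fun i => c ((finRotate n ^ s) i)) ∈ cyclicShift '' (D : Set (Fin n → F)) := by
      rw [show cyclicShift '' (D : Set (Fin n → F)) = D from hD]
      exact ih
    obtain ⟨b, hb, hbc⟩ := h
    have hshift : (fun i => c ((finRotate n ^ (s + 1)) i)) = b := by
      ext i
      have := congrFun hbc (finRotate n i)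
      rw [cyclicShift, Equiv.symm_apply_apply] at this
      rw [pow_succ, Equiv.Perm.mul_apply, this]
    rw [hshift]
    exact hb

end Rotation

/-! ### Runs and pair weight -/

section PairWeight

variable {F : Type*} [Field F] [DecidableEq F] {n : ℕ}

/-- The positions `i` with `c i = 0` that are followed by a nonzero entry of `c`. -/
def runStarts (c : Fin n → F) : Finset (Fin n) :=
  Finset.univ.filter fun i => c i = 0 ∧ c (finRotate n i) ≠ 0

lemma mem_runStarts {c : Fin n → F} {i : Fin n} :
    i ∈ runStarts c ↔ c i = 0 ∧ c (finRotate n i) ≠ 0 := by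
  simp only [runStarts, Finset.mem_filter, Finset.mem_univ, true_and]

lemma pairDist_eq (a b : Fin n → F) :
    pairDist a b = hammingNorm (a - b) + (runStarts (a - b)).card := by
  rw [pairDist, hammingDist, hammingNorm, runStarts, ← Finset.card_union_of_disjoint]
  · congr 1
    ext i
    simp only [pairRead, Finset.mem_filter, Finset.mem_univ, true_and, Finset.mem_union,
      Pi.sub_apply, ne_eq, Prod.mk.injEq, sub_eq_zero]
    tauto
  · rw [Finset.disjoint_filter]
    exact fun i _ h1 h2 => h1 h2.1

lemma hammingNorm_comp_perm (c : Fin n → F) (σ : Equiv.Perm (Fin n)) :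
    hammingNorm (fun i => c (σ i)) = hammingNorm c := by
  refine Finset.card_equiv σ fun i => ?_
  simp

/-- Without run starts, nonvanishing propagates backwards around the whole cycle. -/
lemma hammingNorm_eq_of_runStarts_eq_empty {c : Fin n → F} (hc : c ≠ 0)
    (h : runStarts c = ∅) : hammingNorm c = n := by
  have hstep : ∀ i, c (finRotate n i) ≠ 0 → c i ≠ 0 := by
    intro i hi h0
    have : i ∈ runStarts c := mem_runStarts.2 ⟨h0, hi⟩
    rw [h] at this
    exact absurd this (Finset.notMem_empty i)
  obtain ⟨j, hj⟩ := Function.ne_iff.1 hc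
  have hall : ∀ s i, (finRotate n ^ s) i = j → c i ≠ 0 := by
    intro s
    induction s with
    | zero => rintro i rfl; exact hj
    | succ s ih =>
      intro i hi
      exact hstep i (ih _ (by rwa [pow_succ, Equiv.Perm.mul_apply] at hi))
  have huniv : ∀ i, c i ≠ 0 := by
    intro i
    refine hall (j + (n - i)) i (Fin.ext ?_)
    have h1 := i.2
    rw [val_finRotate_pow, show (i : ℕ) + (j + (n - i)) = j + n by omega, Nat.add_mod_right,
      Nat.mod_eq_of_lt j.2]
  simp [hammingNorm, huniv]

lemma lt_hammingNorm_of_initial {c : Fin n → F}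
    (h : ∀ i : Fin n, ∀ hi : (i : ℕ) + 1 < n, c ⟨i + 1, hi⟩ ≠ 0 → c i ≠ 0) (i : Fin n)
    (hi : c i ≠ 0) : (i : ℕ) < hammingNorm c := by
  have key : ∀ s : ℕ, ∀ j : Fin n, (j : ℕ) + s = i → c j ≠ 0 := by
    intro s
    induction s with
    | zero => intro j hj; rwa [Fin.ext (by simpa using hj) (a := j) (b := i)]
    | succ s ih =>
      intro j hj
      have := i.2
      exact h j (by omega) (ih ⟨j + 1, by omega⟩ (by simp only; omega))
  have hsub : Finset.Iic i ⊆ Finset.univ.filter fun j => c j ≠ 0 := by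
    intro j hj
    have hji : j ≤ i := Finset.mem_Iic.1 hj
    simpa using key (i - j) j (by omega)
  have := Finset.card_le_card hsub
  rw [Fin.card_Iic] at this
  exact this

/-- A codeword of a cyclic code with a single run of nonzero entries can be shifted to the
initial positions. -/
lemma IsCyclic.exists_initial_of_card_runStarts_eq_one {D : Submodule F (Fin n → F)}
    (hD : IsCyclic D) {c : Fin n → F} (hc : c ∈ D) (h1 : (runStarts c).card = 1) :
    ∃ b ∈ D, b ≠ 0 ∧ ∀ i : Fin n, b i ≠ 0 → (i : ℕ) < hammingNorm c := by
  obtain ⟨k, hk⟩ := Finset.card_eq_one.1 h1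
  have hmem : ∀ i, c i = 0 → c (finRotate n i) ≠ 0 → i = k := by
    intro i h0 hne
    have : i ∈ runStarts c := mem_runStarts.2 ⟨h0, hne⟩
    rw [hk] at this
    exact Finset.mem_singleton.1 this
  have hkc : c (finRotate n k) ≠ 0 := by
    have : k ∈ runStarts c := by rw [hk]; exact Finset.mem_singleton_self k
    exact (mem_runStarts.1 this).2
  have hkn := k.2
  refine ⟨_, hD.comp_finRotate_pow_mem hc (k + 1), ?_, ?_⟩
  · intro h
    apply hkc
    have hrot : (finRotate n ^ ((k : ℕ) + 1)) ⟨0, by omega⟩ = finRotate n k := by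
      apply Fin.ext
      rw [val_finRotate_pow, val_finRotate, zero_add]
    rw [← hrot]
    exact congrFun h ⟨0, by omega⟩
  · rw [← hammingNorm_comp_perm c (finRotate n ^ ((k : ℕ) + 1))]
    refine lt_hammingNorm_of_initial fun i hi hne h0 => ?_
    have hrot : finRotate n ((finRotate n ^ ((k : ℕ) + 1)) i) =
        (finRotate n ^ ((k : ℕ) + 1)) ⟨i + 1, hi⟩ := by
      apply Fin.ext
      rw [val_finRotate, val_finRotate_pow, val_finRotate_pow, Nat.mod_add_mod]
      congr 1
      simp only
      omega
    -- The shift by `k + 1` moves the only run start to position `n - 1`, which `i + 1 < n`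
    -- excludes.
    have hik := congrArg Fin.val (hmem _ h0 (hrot ▸ hne))
    rw [val_finRotate_pow] at hik
    rcases lt_or_ge ((i : ℕ) + (k + 1)) n with hlt | hge
    · rw [Nat.mod_eq_of_lt hlt] at hik
      omega
    · rw [Nat.mod_eq_sub_mod hge, Nat.mod_eq_of_lt (by omega)] at hik
      omega

/-- Cyclic neighbours differ mod `l`, even across the wraparound since `l` divides the length; every
nonzero entry is its own run. -/
lemma card_runStarts_of_residue {l m : ℕ} (hl : 1 < l) {c : Fin (l * m) → F} {r : ℕ}
    (hr : ∀ i, c i ≠ 0 → (i : ℕ) % l = r) : (runStarts c).card = hammingNorm c := by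
  refine Finset.card_equiv (finRotate (l * m)) fun i => ?_
  simp only [runStarts, Finset.mem_filter, Finset.mem_univ, true_and, and_iff_right_iff_imp]
  intro h
  by_contra h0
  have h1 := hr _ h
  rw [val_finRotate, Nat.mod_mul_right_mod, ← hr i h0] at h1
  have h2 : (i : ℕ) + 1 ≡ i + 0 [MOD l] := h1
  have h3 := Nat.ModEq.add_left_cancel' _ h2
  rw [Nat.ModEq, Nat.zero_mod, Nat.mod_eq_of_lt hl] at h3
  omega

lemma exists_minPairDist {D : Submodule F (Fin n → F)} (hD : D ≠ ⊥) :
    ∃ c ∈ D, c ≠ 0 ∧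
      minPairDist (D : Set (Fin n → F)) = hammingNorm c + (runStarts c).card := by
  obtain ⟨x, hx, hx0⟩ := (Submodule.ne_bot_iff D).1 hD
  have hne : {m : ℕ | ∃ a ∈ (D : Set (Fin n → F)), ∃ b ∈ (D : Set (Fin n → F)),
      a ≠ b ∧ pairDist a b = m}.Nonempty := ⟨_, x, hx, 0, D.zero_mem, hx0, rfl⟩
  obtain ⟨a, ha, b, hb, hab, h⟩ := Nat.sInf_mem hne
  exact ⟨a - b, D.sub_mem ha hb, sub_ne_zero.2 hab, by rw [minPairDist, ← h, pairDist_eq]⟩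

lemma hammingDist_eq_hammingNorm_sub (a b : Fin n → F) : hammingDist a b = hammingNorm (a - b) := by
  rw [hammingDist_comm, hammingDist_eq_hammingNorm, neg_add_eq_sub]

lemma exists_minHammingDist {D : Submodule F (Fin n → F)} (hD : D ≠ ⊥) :
    ∃ c ∈ D, c ≠ 0 ∧ hammingNorm c = minHammingDist (D : Set (Fin n → F)) := by
  obtain ⟨x, hx, hx0⟩ := (Submodule.ne_bot_iff D).1 hD
  have hne : {m : ℕ | ∃ a ∈ (D : Set (Fin n → F)), ∃ b ∈ (D : Set (Fin n → F)),
      a ≠ b ∧ hammingDist a b = m}.Nonempty := ⟨_, x, hx, 0, D.zero_mem, hx0, rfl⟩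
  obtain ⟨a, ha, b, hb, hab, h⟩ := Nat.sInf_mem hne
  exact ⟨a - b, D.sub_mem ha hb, sub_ne_zero.2 hab,
    by rw [minHammingDist, ← h, hammingDist_eq_hammingNorm_sub]⟩

lemma minHammingDist_le {D : Submodule F (Fin n → F)} {c : Fin n → F} (hc : c ∈ D) (hc0 : c ≠ 0) :
    minHammingDist (D : Set (Fin n → F)) ≤ hammingNorm c :=
  Nat.sInf_le ⟨c, hc, 0, D.zero_mem, hc0, hammingDist_zero_right c⟩

lemma hammingNorm_eq_of_finrank_eq_one {D : Submodule F (Fin n → F)}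
    (hD : Module.finrank F D = 1) {a b : Fin n → F} (ha : a ∈ D) (hb : b ∈ D) (ha0 : a ≠ 0)
    (hb0 : b ≠ 0) : hammingNorm a = hammingNorm b := by
  obtain ⟨r, hr⟩ := (finrank_eq_one_iff_of_nonzero' (⟨a, ha⟩ : D)
    (fun h => ha0 (congrArg Subtype.val h))).1 hD ⟨b, hb⟩
  have hrb : r • a = b := congrArg Subtype.val hr
  have hr0 : r ≠ 0 := by
    rintro rfl
    exact hb0 (by rw [← hrb, zero_smul])
  rw [← hrb, hammingNorm_smul fun _ => smul_right_injective F hr0]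

end PairWeight

end SymbolPair

open SymbolPair

theorem theorem2 {F : Type*} [Field F] [Fintype F] [DecidableEq F]
    (p : ℕ) (hp : p.Prime) [CharP F p]
    (l e : ℕ) (hl : 1 < l) (hlp : Nat.Coprime l p) (he : 0 < e)
    (D : Submodule F (Fin (l * p ^ e) → F)) (hD0 : D ≠ ⊥) (hcyc : SymbolPair.IsCyclic D)
    (g : F[X]) (hg : SymbolPair.IsGeneratorPoly g D)
    (k d : ℕ) (hk : Module.finrank F D = k)
    (hd : SymbolPair.minHammingDist (D : Set (Fin (l * p ^ e) → F)) = d)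
    (hdp : d.Prime)
    (hcond : (l < d ∧ d + k < l * p ^ e) ∨
      ((X ^ l - 1 : F[X]) ∣ g ∧ 2 < d ∧ d + k < l * p ^ e)) :
    d + 3 ≤ SymbolPair.minPairDist (D : Set (Fin (l * p ^ e) → F)) := by
  have : Fact p.Prime := ⟨hp⟩
  have hl0 : 0 < l := by omega
  obtain ⟨c, hc, hc0, hcw⟩ := exists_minPairDist hD0
  obtain ⟨a, ha, ha0, haw⟩ := exists_minHammingDist hD0
  rw [hd] at haw
  have hmin : ∀ b ∈ D, b ≠ 0 → d ≤ hammingNorm b := fun b hb hb0 => hd ▸ minHammingDist_le hb hb0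
  have hdc := hmin c hc hc0
  have hdk : d + k < l * p ^ e := hcond.elim (fun h => h.2) fun h => h.2.2
  have hd2 : 2 < d := hcond.elim (fun h => by omega) fun h => h.2.1
  have hk0 : 0 < k := by
    rw [← hk, Module.finrank_pos_iff, Submodule.nontrivial_iff_ne_bot]
    exact hD0
  rw [hcw]
  by_contra! hlt
  rcases hdc.eq_or_lt with heq | hgt
  · obtain ⟨r, hr⟩ := hg.exists_residue_of_minimum p hl0 hlp hc (heq ▸ hdp)
      (fun b hb hb0 => heq ▸ hmin b hb hb0)
      (hcond.imp (fun h => heq ▸ h.1) fun h => h.1)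
    have := card_runStarts_of_residue hl hr
    omega
  -- Weight at least `d + 1` and pair weight at most `d + 2` leave at most one run.
  rcases Nat.eq_zero_or_pos (runStarts c).card with hzero | hpos
  · have hfull := hammingNorm_eq_of_runStarts_eq_empty hc0 (Finset.card_eq_zero.1 hzero)
    -- Here `d + k < n ≤ d + 2`.
    have hk1 : Module.finrank F D = 1 := by omega
    have := hammingNorm_eq_of_finrank_eq_one hk1 ha hc ha0 hc0
    omega
  · obtain ⟨b, hb, hb0, hinit⟩ :=
      hcyc.exists_initial_of_card_runStarts_eq_one hc (by omega)
    have := hg.lt_finrank_add hb hb0 hinit (by omega)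
    omega
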